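/- Let $K$ be a finite extension of $\mathbb{Q}$. For $n \ge 0$ and a rational function $h = P/Q$ with $P, Q \in K[x_0,\dots,x_n]$ and $Q(0,\dots,0) \neq 0$, with Taylor expansion $h = \sum a_{i_0,\dots,i_n} x_0^{i_0}\cdots x_n^{i_n}$ at the origin, let $\Delta_n(h) = \sum_{i \ge 0} a_{i,\dots,i}\, x^i \in K[[x]]$ be its diagonal. For $f \in K[[x]]$ let $\mathbf{dg}(f)$ be the smallest $n \ge 0$ such that $f = \Delta_n(h)$ for some such $h$, and $\mathbf{dg}(f) = \infty$ if there is none (so $\mathbf{dg}(0) = 0$). For $k \ge 0$ put $$\mathcal{D}_k = \{ f \in K[[x]] : \mathbf{dg}(f) \le k \}, \qquad \mathcal{D} = \{ f \in K[[x]] : \mathbf{dg}(f) < \infty \}.$$ Let $*$ be the Hadamard product, $\left(\sum a_n x^n\right) * \left(\sum b_n x^n\right) = \sum a_n b_n x^n$. Then for all $k_1, k_2 \ge 0$, $$\mathcal{D}_{k_1} * \mathcal{D}_{k_2} \subseteq \mathcal{D}_{k_1 + k_2},$$ that is, $f_1 * f_2 \in \mathcal{D}_{k_1+k_2}$ whenever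 $f_1 \in \mathcal{D}_{k_1}$ and $f_2 \in \mathcal{D}_{k_2}$. Consequently $(\mathcal{D}, +, *)$ is a filtered ring: $\mathcal{D}$ is a $K$-subalgebra of $(K[[x]], +, *)$ (whose unit is $\sum_{n \ge 0} x^n$), and $\mathcal{D}_0 \subseteq \mathcal{D}_1 \subseteq \cdots$ is an increasing chain of $K$-subspaces with union $\mathcal{D}$, such that $\sum_{n\ge 0} x^n \in \mathcal{D}_0$ and $\mathcal{D}_{k_1} * \mathcal{D}_{k_2} \subseteq \mathcal{D}_{k_1+k_2}$. -/

import Mathlib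

namespace DiagonalGrade

open scoped PowerSeries

/-- A power series `h` in finitely many variables is (the Taylor expansion at the origin of) a
rational function `P / Q` with `Q(0, …, 0) ≠ 0`. As such a `Q` is invertible as a power series,
`Q * h = P` says exactly that `h` is the expansion of `P / Q`. -/
def IsRationalSeries {σ K : Type*} [Field K] (h : MvPowerSeries σ K) : Prop :=
  ∃ P Q : MvPolynomial σ K, MvPolynomial.constantCoeff Q ≠ 0 ∧
    (Q : MvPowerSeries σ K) * h = (P : MvPowerSeries σ K)

/-- The diagonal `Δₙ(h) = ∑ᵢ a_{i,…,i} xⁱ` of a series `h` in the `n + 1` variables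
`x₀, …, xₙ`. -/
noncomputable def diagonal {K : Type*} [Field K] (n : ℕ)
    (h : MvPowerSeries (Fin (n + 1)) K) : K⟦X⟧ :=
  PowerSeries.mk fun i =>
    MvPowerSeries.coeff (Finsupp.equivFunOnFinite.symm fun _ : Fin (n + 1) => i) h

/-- `f` is the diagonal of a rational function in the `n + 1` variables `x₀, …, xₙ`. -/
def IsDiagonal {K : Type*} [Field K] (n : ℕ) (f : K⟦X⟧) : Prop :=
  ∃ h : MvPowerSeries (Fin (n + 1)) K, IsRationalSeries h ∧ diagonal n h = f

/-- The diagonal grade: the smallest `n` such that `f` is the diagonal of a rational function in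
`x₀, …, xₙ`, and `⊤` if there is none. The zero series gets grade `0`. -/
noncomputable def dg {K : Type*} [Field K] (f : K⟦X⟧) : ℕ∞ :=
  ⨅ (n : ℕ) (_ : IsDiagonal n f), (n : ℕ∞)

/-- `𝓓ₖ`, the series of diagonal grade at most `k`. -/
def diagonalsLE (K : Type*) [Field K] (k : ℕ) : Set K⟦X⟧ := {f | dg f ≤ k}

/-- `𝓓`, the series of finite diagonal grade. -/
def diagonals (K : Type*) [Field K] : Set K⟦X⟧ := {f | dg f < ⊤}

/-- The Hadamard product `(∑ aₙ xⁿ) * (∑ bₙ xⁿ) = ∑ aₙ bₙ xⁿ`. -/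
noncomputable def hadamard {K : Type*} [Field K] (f g : K⟦X⟧) : K⟦X⟧ :=
  PowerSeries.mk fun n => PowerSeries.coeff n f * PowerSeries.coeff n g

/-- The `K`-vector space `K⟦X⟧`, to be equipped with the Hadamard product as multiplication. -/
def HadamardSeries (K : Type*) [Field K] : Type _ := K⟦X⟧

namespace HadamardSeries

variable {K : Type*} [Field K]

noncomputable instance : AddCommGroup (HadamardSeries K) := inferInstanceAs (AddCommGroup K⟦X⟧)

noncomputable instance : Module K (HadamardSeries K) := inferInstanceAs (Module K K⟦X⟧)

/-- The identity map, as a `K`-linear equivalence. -/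
noncomputable def of : K⟦X⟧ ≃ₗ[K] HadamardSeries K := LinearEquiv.refl K K⟦X⟧

noncomputable instance : Mul (HadamardSeries K) :=
  ⟨fun a b => of (hadamard (of.symm a) (of.symm b))⟩

/-- The unit for the Hadamard product is `∑ xⁿ = 1 / (1 - x)`. -/
noncomputable instance : One (HadamardSeries K) := ⟨of (PowerSeries.mk fun _ => 1)⟩

theorem of_symm_mul (a b : HadamardSeries K) :
    of.symm (a * b) = hadamard (of.symm a) (of.symm b) := rfl

theorem of_symm_one : of.symm (1 : HadamardSeries K) = PowerSeries.mk fun _ => 1 := rfl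

theorem ext_coeff {a b : HadamardSeries K}
    (h : ∀ n, PowerSeries.coeff n (of.symm a) = PowerSeries.coeff n (of.symm b)) : a = b :=
  of.symm.injective (PowerSeries.ext h)

theorem coeff_mul (n : ℕ) (a b : HadamardSeries K) :
    PowerSeries.coeff n (of.symm (a * b)) =
      PowerSeries.coeff n (of.symm a) * PowerSeries.coeff n (of.symm b) := by
  rw [of_symm_mul, hadamard, PowerSeries.coeff_mk]

theorem coeff_one (n : ℕ) : PowerSeries.coeff n (of.symm (1 : HadamardSeries K)) = 1 := by
  rw [of_symm_one, PowerSeries.coeff_mk]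

noncomputable instance : CommRing (HadamardSeries K) where
  __ := (inferInstance : AddCommGroup (HadamardSeries K))
  __ := (inferInstance : Mul (HadamardSeries K))
  __ := (inferInstance : One (HadamardSeries K))
  left_distrib a b c := ext_coeff fun n => by simp only [coeff_mul, map_add, mul_add]
  right_distrib a b c := ext_coeff fun n => by simp only [coeff_mul, map_add, add_mul]
  zero_mul a := ext_coeff fun n => by simp only [coeff_mul, map_zero, zero_mul]
  mul_zero a := ext_coeff fun n => by simp only [coeff_mul, map_zero, mul_zero]
  mul_assoc a b c := ext_coeff fun n => by simp only [coeff_mul, mul_assoc]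
  one_mul a := ext_coeff fun n => by simp only [coeff_mul, coeff_one, one_mul]
  mul_one a := ext_coeff fun n => by simp only [coeff_mul, coeff_one, mul_one]
  mul_comm a b := ext_coeff fun n => by simp only [coeff_mul, mul_comm]

noncomputable instance : Algebra K (HadamardSeries K) :=
  Algebra.ofModule
    (fun c a b => ext_coeff fun n => by
      simp only [coeff_mul, map_smul, smul_eq_mul, mul_assoc])
    (fun c a b => ext_coeff fun n => by
      simp only [coeff_mul, map_smul, smul_eq_mul, mul_left_comm])

end HadamardSeries

end DiagonalGrade

/-!
A series in `x₀, …, xₙ` is rational exactly when it is a quotient of polynomials in `x₀` over the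
ring of rational series in `x₁, …, xₙ`. So if `Δₘ(h₁)` and `Δₙ(h₂)` are two diagonals, view `h₁` and
`h₂` as rational series in one common variable `x₀` whose coefficients are rational series in
disjoint sets of `m` and `n` further variables. Their Hadamard product with respect to `x₀` is a
series in `m + n + 1` variables, and its diagonal is the Hadamard product of the two diagonals.

It is rational because, over any commutative ring `A`, a power series is rational if and only if its
coefficient sequence lies in a finitely generated submodule `M` of `ℕ → A` that is stable under the
shift, and the product of two such submodules is again one.
-/

namespace DiagonalGrade

open scoped PowerSeries Polynomial Matrix

section RationalPowerSeries

variable {A : Type*} [CommRing A]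

/-- Rationality of a power series in one variable over a commutative ring: it is a quotient `p / q`
of polynomials, where `q` has an invertible constant term. -/
def IsRational (f : A⟦X⟧) : Prop :=
  ∃ p q : A[X], IsUnit (q.coeff 0) ∧ (q : A⟦X⟧) * f = p

theorem IsRational.map {B : Type*} [CommRing B] (φ : A →+* B) {f : A⟦X⟧} (hf : IsRational f) :
    IsRational (PowerSeries.map φ f) := by
  obtain ⟨p, q, hq, hqf⟩ := hf
  refine ⟨p.map φ, q.map φ, ?_, ?_⟩
  · rw [Polynomial.coeff_map]
    exact hq.map φ
  · rw [Polynomial.polynomial_map_coe, Polynomial.polynomial_map_coe, ← map_mul, hqf]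

theorem isRational_mk_const (a : A) : IsRational (PowerSeries.mk fun _ => a) := by
  refine ⟨Polynomial.C a, 1 - Polynomial.X, by simp, ?_⟩
  have hmk : (PowerSeries.mk fun _ => a) = PowerSeries.C a * PowerSeries.mk 1 := by ext; simp
  rw [Polynomial.coe_sub, Polynomial.coe_one, Polynomial.coe_X, Polynomial.coe_C, hmk, mul_comm,
    mul_assoc, PowerSeries.mk_one_mul_one_sub_eq_one, mul_one]

/-- Stability of a module of sequences under the shift `(uₙ) ↦ (uₙ₊₁)`. -/
def IsShiftStable (M : Submodule A (ℕ → A)) : Prop :=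
  ∀ u ∈ M, u ∘ Nat.succ ∈ M

theorem IsShiftStable.mul {M N : Submodule A (ℕ → A)} (hM : IsShiftStable M)
    (hN : IsShiftStable N) : IsShiftStable (M * N) := by
  intro w hw
  induction hw using Submodule.mul_induction_on' with
  | mem_mul_mem u hu v hv => exact Submodule.mul_mem_mul (hM u hu) (hN v hv)
  | add _ _ _ _ hx hy => exact add_mem hx hy

theorem mk_eq_C_add_X_mul_mk_succ (u : ℕ → A) :
    PowerSeries.mk u = PowerSeries.C (u 0) + PowerSeries.X * PowerSeries.mk (u ∘ Nat.succ) := by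
  ext (_ | n)
  · simp
  · simp [PowerSeries.coeff_succ_X_mul]

/-- If the shift acts on `v` through the matrix `B`, the vector `F` of generating functions
satisfies `(1 - X • B) F = v(0)`, and Cramer's rule applies. -/
theorem exists_charpolyRev_mul_mk_eq_coe {ι : Type*} [Fintype ι] [DecidableEq ι]
    {v : ι → ℕ → A} {B : Matrix ι ι A} (hv : ∀ i, v i ∘ Nat.succ = ∑ j, B i j • v j) :
    ∃ p : ι → A[X], ∀ i, (B.charpolyRev : A⟦X⟧) * PowerSeries.mk (v i) = p i := by
  let φ : A[X] →+* A⟦X⟧ := Polynomial.coeToPowerSeries.ringHom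
  let N : Matrix ι ι A[X] := 1 - (Polynomial.X : A[X]) • B.map Polynomial.C
  let F : ι → A⟦X⟧ := fun i => PowerSeries.mk (v i)
  let v₀ : ι → A[X] := fun i => Polynomial.C (v i 0)
  have hN : N.map φ = 1 - (PowerSeries.X : A⟦X⟧) • B.map PowerSeries.C := by
    ext1 i j
    simp only [N, φ, Matrix.map_apply, Matrix.sub_apply, Matrix.smul_apply, smul_eq_mul, map_sub,
      map_mul, Polynomial.coeToPowerSeries.ringHom_apply, Polynomial.coe_X, Polynomial.coe_C,
      Matrix.one_apply, apply_ite, Polynomial.coe_one, Polynomial.coe_zero]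
  have hBF : B.map PowerSeries.C *ᵥ F = fun i => PowerSeries.mk (v i ∘ Nat.succ) := by
    ext i n
    simp [Matrix.mulVec, dotProduct, F, hv]
  have hNF : N.map φ *ᵥ F = φ ∘ v₀ := by
    ext1 i
    rw [hN, Matrix.sub_mulVec, Matrix.one_mulVec, Matrix.smul_mulVec, hBF]
    exact (sub_eq_of_eq_add (mk_eq_C_add_X_mul_mk_succ (v i))).trans (Polynomial.coe_C _).symm
  refine ⟨N.adjugate *ᵥ v₀, fun i => ?_⟩
  have hcramer : φ N.det • F = φ ∘ (N.adjugate *ᵥ v₀) := by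
    calc φ N.det • F = (φ.mapMatrix N).adjugate *ᵥ (φ.mapMatrix N *ᵥ F) := by
          rw [Matrix.mulVec_mulVec, Matrix.adjugate_mul, Matrix.smul_mulVec, Matrix.one_mulVec,
            RingHom.map_det]
      _ = N.adjugate.map φ *ᵥ (φ ∘ v₀) := by
          rw [← RingHom.map_adjugate, RingHom.mapMatrix_apply, RingHom.mapMatrix_apply, hNF]
      _ = φ ∘ (N.adjugate *ᵥ v₀) := funext fun i => (RingHom.map_mulVec φ _ _ i).symm
  exact congrFun hcramer i

theorem IsShiftStable.isRational_mk {M : Submodule A (ℕ → A)} (hM : IsShiftStable M) (hfg : M.FG)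
    {u : ℕ → A} (hu : u ∈ M) : IsRational (PowerSeries.mk u) := by
  obtain ⟨r, v, rfl⟩ := Submodule.fg_iff_exists_fin_generating_family.1 hfg
  have hshift (i : Fin r) : ∃ c : Fin r → A, ∑ j, c j • v j = v i ∘ Nat.succ :=
    (Submodule.mem_span_range_iff_exists_fun A).1 (hM _ (Submodule.subset_span ⟨i, rfl⟩))
  choose B hB using hshift
  obtain ⟨p, hp⟩ := exists_charpolyRev_mul_mk_eq_coe (B := .of B) fun i => (hB i).symm
  obtain ⟨a, rfl⟩ := (Submodule.mem_span_range_iff_exists_fun A).1 hu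
  have hmk : PowerSeries.mk (∑ i, a i • v i) = ∑ i, PowerSeries.C (a i) * PowerSeries.mk (v i) := by
    ext n; simp
  refine ⟨∑ i, Polynomial.C (a i) * p i, Matrix.charpolyRev (.of B), ?_, ?_⟩
  · rw [Polynomial.coeff_zero_eq_eval_zero, Matrix.eval_charpolyRev]
    exact isUnit_one
  · rw [hmk, Finset.mul_sum, ← Polynomial.coeToPowerSeries.ringHom_apply (φ := ∑ i, _), map_sum]
    refine Finset.sum_congr rfl fun i _ => ?_
    rw [mul_left_comm, hp, Polynomial.coeToPowerSeries.ringHom_apply, Polynomial.coe_mul,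
      Polynomial.coe_C]

/-- The coefficient sequences of the series `g * p`, where `p` runs over the polynomials of degree
less than `N`. -/
noncomputable def coeffsMulDegreeLT (g : A⟦X⟧) (N : ℕ) : Submodule A (ℕ → A) :=
  (Polynomial.degreeLT A N).map
    (LinearMap.pi (PowerSeries.coeff (R := A)) ∘ₗ LinearMap.mulLeft A g ∘ₗ
      (Polynomial.coeToPowerSeries.algHom A).toLinearMap)

theorem mem_coeffsMulDegreeLT {g : A⟦X⟧} {N : ℕ} {u : ℕ → A} :
    u ∈ coeffsMulDegreeLT g N ↔
      ∃ p : A[X], p.degree < N ∧ g * (p : A⟦X⟧) = PowerSeries.mk u := by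
  rw [coeffsMulDegreeLT, Submodule.mem_map]
  refine exists_congr fun p => and_congr Polynomial.mem_degreeLT ?_
  rw [funext_iff, PowerSeries.ext_iff]
  refine forall_congr' fun n => ?_
  simp

theorem coeffsMulDegreeLT_fg (g : A⟦X⟧) (N : ℕ) : (coeffsMulDegreeLT g N).FG := by
  classical
  exact Submodule.FG.map _ ⟨_, Polynomial.degreeLT_eq_span_X_pow.symm⟩

/-- If `u` generates `g * p` and `a = u 0`, then the shift of `u` generates
`g * ((p - a * q) / X)`. -/
theorem isShiftStable_coeffsMulDegreeLT {q : A[X]} {g : A⟦X⟧} (hgq : g * q = 1) {N : ℕ}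
    (hN : q.natDegree ≤ N) : IsShiftStable (coeffsMulDegreeLT g N) := by
  intro u hu
  obtain ⟨p, hp, hpu⟩ := mem_coeffsMulDegreeLT.1 hu
  set r : A[X] := p - Polynomial.C (u 0) * q with hr
  have hpq : (p : A⟦X⟧) = PowerSeries.mk u * q := by rw [← hpu, mul_right_comm, hgq, one_mul]
  have hp₀ : p.coeff 0 = u 0 * q.coeff 0 := by
    simpa using congrArg PowerSeries.constantCoeff hpq
  have hXr : Polynomial.X * r.divX = r := by simpa [hr, hp₀] using r.X_mul_divX_add
  refine mem_coeffsMulDegreeLT.2 ⟨r.divX, ?_, ?_⟩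
  · rw [Polynomial.degree_lt_iff_coeff_zero] at hp ⊢
    intro m hm
    have hqm : q.coeff (m + 1) = 0 :=
      Polynomial.coeff_eq_zero_of_natDegree_lt (Nat.lt_succ_of_le (hN.trans hm))
    rw [Polynomial.coeff_divX, hr, Polynomial.coeff_sub, Polynomial.coeff_C_mul, hqm,
      hp _ (hm.trans m.le_succ), mul_zero, sub_zero]
  · apply PowerSeries.X_mul_cancel
    calc PowerSeries.X * (g * (r.divX : A⟦X⟧)) = g * (r : A⟦X⟧) := by
          rw [mul_left_comm, ← Polynomial.coe_X, ← Polynomial.coe_mul, hXr]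
      _ = PowerSeries.mk u - PowerSeries.C (u 0) := by
          rw [hr, Polynomial.coe_sub, Polynomial.coe_mul, Polynomial.coe_C, mul_sub, hpu,
            mul_left_comm, hgq, mul_one]
      _ = PowerSeries.X * PowerSeries.mk (u ∘ Nat.succ) :=
          sub_eq_of_eq_add' (mk_eq_C_add_X_mul_mk_succ u)

theorem isRational_iff_exists_isShiftStable {f : A⟦X⟧} :
    IsRational f ↔ ∃ M : Submodule A (ℕ → A),
      M.FG ∧ IsShiftStable M ∧ (fun n => PowerSeries.coeff n f) ∈ M := by
  have hf : PowerSeries.mk (fun n => PowerSeries.coeff n f) = f := by ext; simp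
  constructor
  · rintro ⟨p, q, hq, hqf⟩
    obtain ⟨g, hqg⟩ : ∃ g : A⟦X⟧, q * g = 1 := by
      refine IsUnit.exists_right_inv (PowerSeries.isUnit_iff_constantCoeff.2 ?_)
      rwa [Polynomial.constantCoeff_coe]
    have hgq : g * q = 1 := by rw [mul_comm, hqg]
    refine ⟨coeffsMulDegreeLT g (max q.natDegree (p.natDegree + 1)), coeffsMulDegreeLT_fg _ _,
      isShiftStable_coeffsMulDegreeLT hgq (le_max_left _ _),
      mem_coeffsMulDegreeLT.2 ⟨p, ?_, ?_⟩⟩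
    · refine Polynomial.degree_le_natDegree.trans_lt (Nat.cast_lt.2 ?_)
      exact Nat.lt_of_succ_le (le_max_right _ _)
    · rw [hf, ← hqf, ← mul_assoc, hgq, one_mul]
  · rintro ⟨M, hfg, hM, hfM⟩
    rw [← hf]
    exact hM.isRational_mk hfg hfM

theorem IsRational.hadamard {f g : A⟦X⟧} (hf : IsRational f) (hg : IsRational g) :
    IsRational (PowerSeries.mk fun n => PowerSeries.coeff n f * PowerSeries.coeff n g) := by
  obtain ⟨M, hMfg, hM, hfM⟩ := isRational_iff_exists_isShiftStable.1 hf
  obtain ⟨N, hNfg, hN, hgN⟩ := isRational_iff_exists_isShiftStable.1 hg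
  exact (hM.mul hN).isRational_mk (hMfg.mul hNfg) (Submodule.mul_mem_mul hfM hgN)

end RationalPowerSeries

section RationalSeries

theorem constantCoeff_coe {σ R : Type*} [CommSemiring R] (P : MvPolynomial σ R) :
    MvPowerSeries.constantCoeff (P : MvPowerSeries σ R) = MvPolynomial.constantCoeff P := by
  rw [← MvPowerSeries.coeff_zero_eq_constantCoeff_apply, MvPolynomial.coeff_coe,
    MvPolynomial.constantCoeff_eq]

variable {σ τ K : Type*} [Field K]

theorem isRationalSeries_coe (P : MvPolynomial σ K) : IsRationalSeries (P : MvPowerSeries σ K) :=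
  ⟨P, 1, by simp, by simp⟩

theorem IsRationalSeries.add {a b : MvPowerSeries σ K} (ha : IsRationalSeries a)
    (hb : IsRationalSeries b) : IsRationalSeries (a + b) := by
  obtain ⟨P, Q, hQ, hQa⟩ := ha
  obtain ⟨P', Q', hQ', hQb⟩ := hb
  refine ⟨P * Q' + Q * P', Q * Q', by simpa using ⟨hQ, hQ'⟩, ?_⟩
  push_cast
  rw [← hQa, ← hQb]
  ring

theorem IsRationalSeries.mul {a b : MvPowerSeries σ K} (ha : IsRationalSeries a)
    (hb : IsRationalSeries b) : IsRationalSeries (a * b) := by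
  obtain ⟨P, Q, hQ, hQa⟩ := ha
  obtain ⟨P', Q', hQ', hQb⟩ := hb
  refine ⟨P * P', Q * Q', by simpa using ⟨hQ, hQ'⟩, ?_⟩
  push_cast
  rw [← hQa, ← hQb, mul_mul_mul_comm]

theorem IsRationalSeries.inv {h : MvPowerSeries σ K} (hh : IsRationalSeries h) :
    IsRationalSeries h⁻¹ := by
  by_cases h₀ : MvPowerSeries.constantCoeff h = 0
  · rw [MvPowerSeries.inv_eq_zero.2 h₀]
    exact isRationalSeries_coe 0
  · obtain ⟨P, Q, hQ, hQh⟩ := hh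
    refine ⟨Q, P, ?_, ?_⟩
    · rw [← constantCoeff_coe, ← hQh, map_mul, constantCoeff_coe]
      exact mul_ne_zero hQ h₀
    · rw [← hQh, mul_assoc, MvPowerSeries.mul_inv_cancel h h₀, mul_one]

theorem IsRationalSeries.of_mul {q h : MvPowerSeries σ K} (hq : IsRationalSeries q)
    (hq₀ : MvPowerSeries.constantCoeff q ≠ 0) (hqh : IsRationalSeries (q * h)) :
    IsRationalSeries h := by
  rw [← one_mul h, ← MvPowerSeries.inv_mul_cancel q hq₀, mul_assoc]
  exact hq.inv.mul hqh

theorem IsRationalSeries.rename (e : σ ↪ τ) {h : MvPowerSeries σ K} (hh : IsRationalSeries h) :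
    IsRationalSeries (MvPowerSeries.rename e h) := by
  obtain ⟨P, Q, hQ, hQh⟩ := hh
  refine ⟨MvPolynomial.rename e P, MvPolynomial.rename e Q, ?_, ?_⟩
  · rwa [MvPolynomial.constantCoeff_rename]
  · rw [← MvPowerSeries.rename_coe, ← MvPowerSeries.rename_coe, ← map_mul, hQh]

/-- The local ring of rational functions without a pole at the origin, as an algebra of power
series. -/
def rationalSeries (σ K : Type*) [Field K] : Subalgebra K (MvPowerSeries σ K) where
  carrier := {h | IsRationalSeries h}
  add_mem' := IsRationalSeries.add
  mul_mem' := IsRationalSeries.mul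
  algebraMap_mem' r := MvPolynomial.coe_C (σ := σ) r ▸ isRationalSeries_coe (MvPolynomial.C r)

theorem isUnit_rationalSeries_iff {h : rationalSeries σ K} :
    IsUnit h ↔ MvPowerSeries.constantCoeff (h : MvPowerSeries σ K) ≠ 0 := by
  constructor
  · intro hu
    exact ((hu.map (rationalSeries σ K).val).map
      (MvPowerSeries.constantCoeff (σ := σ) (R := K))).ne_zero
  · intro h₀
    exact IsUnit.of_mul_eq_one ⟨_, IsRationalSeries.inv h.2⟩
      (Subtype.ext (MvPowerSeries.mul_inv_cancel _ h₀))

/-- Polynomials as rational series. -/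
noncomputable def polynomialToRational (σ K : Type*) [Field K] :
    MvPolynomial σ K →+* rationalSeries σ K :=
  MvPolynomial.coeToMvPowerSeries.ringHom.codRestrict (rationalSeries σ K) isRationalSeries_coe

theorem coe_polynomialToRational (P : MvPolynomial σ K) :
    (polynomialToRational σ K P : MvPowerSeries σ K) = P := rfl

/-- Renaming of the variables of a rational series along an embedding. -/
noncomputable def renameRational (K : Type*) [Field K] (e : σ ↪ τ) :
    rationalSeries σ K →ₐ[K] rationalSeries τ K :=
  ((MvPowerSeries.rename e).comp (rationalSeries σ K).val).codRestrict (rationalSeries τ K)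
    fun h => IsRationalSeries.rename e h.2

theorem coe_renameRational (e : σ ↪ τ) (h : rationalSeries σ K) :
    (renameRational K e h : MvPowerSeries τ K) = MvPowerSeries.rename e (h : MvPowerSeries σ K) :=
  rfl

end RationalSeries

section DisjointVariables

variable {σ₁ σ₂ τ : Type*} {e₁ : σ₁ ↪ τ} {e₂ : σ₂ ↪ τ}

theorem embDomain_add_embDomain_inj {M : Type*} [AddZeroClass M]
    (he : Disjoint (Set.range e₁) (Set.range e₂)) {x m₁ : σ₁ →₀ M} {y m₂ : σ₂ →₀ M} :
    x.embDomain e₁ + y.embDomain e₂ = m₁.embDomain e₁ + m₂.embDomain e₂ ↔ x = m₁ ∧ y = m₂ := by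
  refine ⟨fun h => ⟨?_, ?_⟩, by rintro ⟨rfl, rfl⟩; rfl⟩
  · ext i
    have hi : e₁ i ∉ Set.range e₂ := he.notMem_of_mem_left ⟨i, rfl⟩
    simpa [Finsupp.embDomain_of_notMem_range _ _ _ hi] using DFunLike.congr_fun h (e₁ i)
  · ext j
    have hj : e₂ j ∉ Set.range e₁ := he.notMem_of_mem_right ⟨j, rfl⟩
    simpa [Finsupp.embDomain_of_notMem_range _ _ _ hj] using DFunLike.congr_fun h (e₂ j)

theorem coeff_rename_mul_rename {R : Type*} [CommSemiring R]
    (he : Disjoint (Set.range e₁) (Set.range e₂)) (a : MvPowerSeries σ₁ R)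
    (b : MvPowerSeries σ₂ R) (m₁ : σ₁ →₀ ℕ) (m₂ : σ₂ →₀ ℕ) :
    MvPowerSeries.coeff (m₁.embDomain e₁ + m₂.embDomain e₂)
        (MvPowerSeries.rename e₁ a * MvPowerSeries.rename e₂ b) =
      MvPowerSeries.coeff m₁ a * MvPowerSeries.coeff m₂ b := by
  classical
  rw [MvPowerSeries.coeff_mul, Finset.sum_eq_single (m₁.embDomain e₁, m₂.embDomain e₂),
    MvPowerSeries.coeff_embDomain_rename, MvPowerSeries.coeff_embDomain_rename]
  · rintro ⟨x, y⟩ hxy hne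
    rw [Finset.HasAntidiagonal.mem_antidiagonal] at hxy
    by_cases hx : x ∈ Set.range (Finsupp.mapDomain e₁)
    · by_cases hy : y ∈ Set.range (Finsupp.mapDomain e₂)
      · obtain ⟨x, rfl⟩ := hx
        obtain ⟨y, rfl⟩ := hy
        rw [← Finsupp.embDomain_eq_mapDomain, ← Finsupp.embDomain_eq_mapDomain] at hxy hne
        obtain ⟨rfl, rfl⟩ := (embDomain_add_embDomain_inj he).1 hxy
        exact absurd rfl hne
      · rw [MvPowerSeries.coeff_rename_eq_zero _ _ hy, mul_zero]
    · rw [MvPowerSeries.coeff_rename_eq_zero _ _ hx, zero_mul]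
  · intro hnotMem
    refine absurd ?_ hnotMem
    rw [Finset.HasAntidiagonal.mem_antidiagonal]

end DisjointVariables

section Slices

variable {n : ℕ}

theorem finSuccEquiv_coe {R : Type*} [CommSemiring R] (P : MvPolynomial (Fin (n + 1)) R) :
    MvPowerSeries.finSuccEquiv R n (P : MvPowerSeries (Fin (n + 1)) R) =
      PowerSeries.map MvPolynomial.coeToMvPowerSeries.ringHom
        (MvPolynomial.finSuccEquiv R n P : (MvPolynomial (Fin n) R)⟦X⟧) := by
  ext i m
  rw [MvPowerSeries.coeff_coeff_finSuccEquiv, PowerSeries.coeff_map, Polynomial.coeff_coe,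
    MvPolynomial.coeToMvPowerSeries.ringHom_apply, MvPolynomial.coeff_coe, MvPolynomial.coeff_coe,
    MvPolynomial.finSuccEquiv_coeff_coeff]

theorem constantCoeff_coeff_zero_finSuccEquiv {R : Type*} [CommSemiring R]
    (P : MvPolynomial (Fin (n + 1)) R) :
    MvPolynomial.constantCoeff ((MvPolynomial.finSuccEquiv R n P).coeff 0) =
      MvPolynomial.constantCoeff P := by
  rw [MvPolynomial.constantCoeff_eq, MvPolynomial.finSuccEquiv_coeff_coeff, Finsupp.cons_zero_zero,
    MvPolynomial.constantCoeff_eq]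

variable {K : Type*} [Field K]

/-- The series in `n + 1` variables whose coefficients as a power series in the first variable are
given rational series in the other `n` variables. -/
noncomputable def ofSlices (K : Type*) [Field K] (n : ℕ) :
    (rationalSeries (Fin n) K)⟦X⟧ →+* MvPowerSeries (Fin (n + 1)) K :=
  (MvPowerSeries.finSuccEquiv K n).symm.toRingEquiv.toRingHom.comp
    (PowerSeries.map (algebraMap (rationalSeries (Fin n) K) (MvPowerSeries (Fin n) K)))

theorem finSuccEquiv_ofSlices (s : (rationalSeries (Fin n) K)⟦X⟧) :
    MvPowerSeries.finSuccEquiv K n (ofSlices K n s) = PowerSeries.map (algebraMap _ _) s :=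
  (MvPowerSeries.finSuccEquiv K n).apply_symm_apply _

theorem coeff_cons_ofSlices (s : (rationalSeries (Fin n) K)⟦X⟧) (i : ℕ) (m : Fin n →₀ ℕ) :
    MvPowerSeries.coeff (m.cons i) (ofSlices K n s) =
      MvPowerSeries.coeff m (PowerSeries.coeff i s).val := by
  rw [← MvPowerSeries.coeff_coeff_finSuccEquiv, finSuccEquiv_ofSlices, PowerSeries.coeff_map]
  rfl

theorem constantCoeff_ofSlices_coe (q : (rationalSeries (Fin n) K)[X]) :
    MvPowerSeries.constantCoeff (ofSlices K n q) =
      MvPowerSeries.constantCoeff (q.coeff 0 : MvPowerSeries (Fin n) K) := by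
  rw [← MvPowerSeries.coeff_zero_eq_constantCoeff_apply, ← Finsupp.cons_zero_zero,
    coeff_cons_ofSlices, Polynomial.coeff_coe, MvPowerSeries.coeff_zero_eq_constantCoeff_apply]

theorem ofSlices_map_polynomialToRational (P : MvPolynomial (Fin (n + 1)) K) :
    ofSlices K n ((MvPolynomial.finSuccEquiv K n P).map (polynomialToRational (Fin n) K) :
      (rationalSeries (Fin n) K)[X]) = P := by
  apply (MvPowerSeries.finSuccEquiv K n).injective
  rw [finSuccEquiv_coe, finSuccEquiv_ofSlices, Polynomial.polynomial_map_coe]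
  rfl

theorem ofSlices_X : ofSlices K n PowerSeries.X = MvPowerSeries.X 0 := by
  apply (MvPowerSeries.finSuccEquiv K n).injective
  rw [finSuccEquiv_ofSlices, PowerSeries.map_X, MvPowerSeries.finSuccEquiv_X_zero]

theorem isRationalSeries_ofSlices_C (a : rationalSeries (Fin n) K) :
    IsRationalSeries (ofSlices K n (PowerSeries.C a)) := by
  obtain ⟨P, Q, hQ, hQa⟩ := a.2
  refine ⟨(MvPolynomial.finSuccEquiv K n).symm (Polynomial.C P),
    (MvPolynomial.finSuccEquiv K n).symm (Polynomial.C Q), ?_, ?_⟩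
  · rwa [← constantCoeff_coeff_zero_finSuccEquiv, AlgEquiv.apply_symm_apply,
      Polynomial.coeff_C_zero]
  · apply (MvPowerSeries.finSuccEquiv K n).injective
    simp only [map_mul, finSuccEquiv_coe, finSuccEquiv_ofSlices, AlgEquiv.apply_symm_apply,
      Polynomial.coe_C, PowerSeries.map_C]
    rw [← map_mul]
    exact congrArg PowerSeries.C hQa

theorem isRationalSeries_ofSlices_coe (p : (rationalSeries (Fin n) K)[X]) :
    IsRationalSeries (ofSlices K n p) := by
  induction p using Polynomial.induction_on' with
  | add p q hp hq =>
    rw [Polynomial.coe_add, map_add]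
    exact hp.add hq
  | monomial i a =>
    have hX : IsRationalSeries (MvPowerSeries.X 0 : MvPowerSeries (Fin (n + 1)) K) :=
      MvPolynomial.coe_X (R := K) (0 : Fin (n + 1)) ▸ isRationalSeries_coe _
    rw [← Polynomial.C_mul_X_pow_eq_monomial, Polynomial.coe_mul, Polynomial.coe_pow,
      Polynomial.coe_C, Polynomial.coe_X, map_mul, map_pow, ofSlices_X]
    exact (isRationalSeries_ofSlices_C a).mul ((rationalSeries _ K).pow_mem hX i)

theorem IsRational.isRationalSeries_ofSlices {s : (rationalSeries (Fin n) K)⟦X⟧}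
    (hs : IsRational s) : IsRationalSeries (ofSlices K n s) := by
  obtain ⟨p, q, hq, hqs⟩ := hs
  refine (isRationalSeries_ofSlices_coe q).of_mul ?_ ?_
  · rw [constantCoeff_ofSlices_coe]
    exact isUnit_rationalSeries_iff.1 hq
  · rw [← map_mul, hqs]
    exact isRationalSeries_ofSlices_coe p

theorem IsRationalSeries.exists_ofSlices_eq {h : MvPowerSeries (Fin (n + 1)) K}
    (hh : IsRationalSeries h) :
    ∃ s : (rationalSeries (Fin n) K)⟦X⟧, IsRational s ∧ ofSlices K n s = h := by
  obtain ⟨P, Q, hQ, hQh⟩ := hh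
  let p := (MvPolynomial.finSuccEquiv K n P).map (polynomialToRational (Fin n) K)
  let q := (MvPolynomial.finSuccEquiv K n Q).map (polynomialToRational (Fin n) K)
  have hq : IsUnit (q.coeff 0) := by
    rwa [isUnit_rationalSeries_iff, Polynomial.coeff_map, coe_polynomialToRational,
      constantCoeff_coe, constantCoeff_coeff_zero_finSuccEquiv]
  obtain ⟨g, hqg⟩ : ∃ g : (rationalSeries (Fin n) K)⟦X⟧, q * g = 1 := by
    refine IsUnit.exists_right_inv (PowerSeries.isUnit_iff_constantCoeff.2 ?_)
    rwa [Polynomial.constantCoeff_coe]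
  refine ⟨g * p, ⟨p, q, hq, ?_⟩, ?_⟩
  · rw [← mul_assoc, hqg, one_mul]
  · rw [map_mul, ofSlices_map_polynomialToRational, ← hQh, ← ofSlices_map_polynomialToRational Q,
      ← mul_assoc, ← map_mul, mul_comm g, hqg, map_one, one_mul]

end Slices

section Diagonal

variable {K : Type*} [Field K] {m n : ℕ}

/-- The multi-index `(i, …, i)` of length `n`. -/
noncomputable def constIndex (n i : ℕ) : Fin n →₀ ℕ :=
  Finsupp.equivFunOnFinite.symm fun _ => i

theorem constIndex_apply (n i : ℕ) (j : Fin n) : constIndex n i j = i := rfl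

theorem constIndex_succ (n i : ℕ) : constIndex (n + 1) i = (constIndex n i).cons i := by
  ext j
  cases j using Fin.cases <;> simp [constIndex_apply]

theorem disjoint_range_castAddEmb_natAddEmb (m n : ℕ) :
    Disjoint (Set.range (Fin.castAddEmb n : Fin m ↪ Fin (m + n)))
      (Set.range (Fin.natAddEmb m : Fin n ↪ Fin (m + n))) := by
  rw [Set.disjoint_range_iff]
  intro i j
  exact Fin.ne_of_val_ne (i.isLt.trans_le (Nat.le_add_right m j)).ne

theorem constIndex_add (m n i : ℕ) :
    constIndex (m + n) i = (constIndex m i).embDomain (Fin.castAddEmb n) +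
      (constIndex n i).embDomain (Fin.natAddEmb m) := by
  have hdisj := disjoint_range_castAddEmb_natAddEmb m n
  ext j
  rw [Finsupp.add_apply, constIndex_apply]
  refine Fin.addCases (fun j => ?_) (fun j => ?_) j
  · have hj : Fin.castAdd n j ∉ Set.range (Fin.natAddEmb m) := hdisj.notMem_of_mem_left ⟨j, rfl⟩
    rw [Finsupp.embDomain_of_notMem_range _ _ _ hj, add_zero]
    exact (Finsupp.embDomain_apply_self (Fin.castAddEmb n) (constIndex m i) j).symm
  · have hj : Fin.natAdd m j ∉ Set.range (Fin.castAddEmb n) := hdisj.notMem_of_mem_right ⟨j, rfl⟩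
    rw [Finsupp.embDomain_of_notMem_range _ _ _ hj, zero_add]
    exact (Finsupp.embDomain_apply_self (Fin.natAddEmb m) (constIndex n i) j).symm

theorem coeff_diagonal (i : ℕ) (h : MvPowerSeries (Fin (n + 1)) K) :
    PowerSeries.coeff i (diagonal n h) = MvPowerSeries.coeff (constIndex (n + 1) i) h :=
  PowerSeries.coeff_mk _ _

theorem isDiagonal_iff_exists_slices {f : K⟦X⟧} :
    IsDiagonal n f ↔ ∃ s : (rationalSeries (Fin n) K)⟦X⟧, IsRational s ∧ ∀ i,
      PowerSeries.coeff i f =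
        MvPowerSeries.coeff (constIndex n i) (PowerSeries.coeff i s).val := by
  constructor
  · rintro ⟨h, hh, rfl⟩
    obtain ⟨s, hs, rfl⟩ := hh.exists_ofSlices_eq
    refine ⟨s, hs, fun i => ?_⟩
    rw [coeff_diagonal, constIndex_succ, coeff_cons_ofSlices]
  · rintro ⟨s, hs, hfs⟩
    refine ⟨ofSlices K n s, hs.isRationalSeries_ofSlices, ?_⟩
    ext i
    rw [coeff_diagonal, constIndex_succ, coeff_cons_ofSlices, hfs]

theorem IsDiagonal.hadamard {f g : K⟦X⟧} (hf : IsDiagonal m f) (hg : IsDiagonal n g) :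
    IsDiagonal (m + n) (hadamard f g) := by
  obtain ⟨s, hs, hfs⟩ := isDiagonal_iff_exists_slices.1 hf
  obtain ⟨t, ht, hgt⟩ := isDiagonal_iff_exists_slices.1 hg
  have hst := (hs.map (renameRational K (Fin.castAddEmb n)).toRingHom).hadamard
    (ht.map (renameRational K (Fin.natAddEmb m)).toRingHom)
  refine isDiagonal_iff_exists_slices.2 ⟨_, hst, fun i => ?_⟩
  simp only [DiagonalGrade.hadamard, PowerSeries.coeff_mk, PowerSeries.coeff_map,
    AlgHom.toRingHom_eq_coe, RingHom.coe_coe, MulMemClass.coe_mul, coe_renameRational]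
  rw [hfs, hgt, constIndex_add, coeff_rename_mul_rename (disjoint_range_castAddEmb_natAddEmb m n)]

/-- The series is the diagonal of `h(x₁, …, xₙ) / (1 - x₀)`. -/
theorem isDiagonal_mk_coeff_constIndex {h : MvPowerSeries (Fin n) K} (hh : IsRationalSeries h) :
    IsDiagonal n (PowerSeries.mk fun i => MvPowerSeries.coeff (constIndex n i) h) := by
  let a : rationalSeries (Fin n) K := ⟨h, hh⟩
  refine isDiagonal_iff_exists_slices.2 ⟨_, isRational_mk_const a, fun i => ?_⟩
  rw [PowerSeries.coeff_mk, PowerSeries.coeff_mk]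

theorem isDiagonal_zero_mk_one : IsDiagonal 0 (PowerSeries.mk fun _ => 1 : K⟦X⟧) := by
  have h := isDiagonal_mk_coeff_constIndex (n := 0) (K := K) (one_mem (rationalSeries (Fin 0) K))
  convert h using 3 with i
  rw [Subsingleton.elim (constIndex 0 i) 0, MvPowerSeries.coeff_zero_one]

theorem IsDiagonal.succ {f : K⟦X⟧} (hf : IsDiagonal n f) : IsDiagonal (n + 1) f := by
  obtain ⟨h, hh, rfl⟩ := hf
  exact isDiagonal_mk_coeff_constIndex hh

theorem IsDiagonal.mono (hmn : m ≤ n) {f : K⟦X⟧} (hf : IsDiagonal m f) : IsDiagonal n f := by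
  induction n, hmn using Nat.le_induction with
  | base => exact hf
  | succ n _ ih => exact ih.succ

theorem mem_diagonalsLE_iff {f : K⟦X⟧} : f ∈ diagonalsLE K n ↔ IsDiagonal n f := by
  have hlt : f ∈ diagonalsLE K n ↔ dg f < n + 1 :=
    (ENat.lt_add_one_iff (ENat.natCast_ne_top n)).symm
  simp only [hlt, dg, iInf_lt_iff]
  constructor
  · rintro ⟨k, hk, hkn⟩
    exact hk.mono (Nat.lt_succ_iff.1 (by exact_mod_cast hkn))
  · intro hf
    exact ⟨n, hf, by exact_mod_cast n.lt_succ_self⟩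

theorem mem_diagonals_iff {f : K⟦X⟧} : f ∈ diagonals K ↔ ∃ k, IsDiagonal k f := by
  change dg f < ⊤ ↔ _
  simp [dg, iInf_lt_iff]

/-- The diagonal `Δₙ` as a linear map. -/
noncomputable def diagonalLinearMap (K : Type*) [Field K] (n : ℕ) :
    MvPowerSeries (Fin (n + 1)) K →ₗ[K] K⟦X⟧ where
  toFun := diagonal n
  map_add' a b := by ext; simp only [coeff_diagonal, map_add]
  map_smul' c a := by ext; simp only [coeff_diagonal, map_smul, RingHom.id_apply]

/-- The subspace of diagonals of rational functions in `n + 1` variables. -/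
noncomputable def diagonalSubmodule (K : Type*) [Field K] (n : ℕ) :
    Submodule K (HadamardSeries K) :=
  (rationalSeries (Fin (n + 1)) K).toSubmodule.map
    (HadamardSeries.of.toLinearMap ∘ₗ diagonalLinearMap K n)

theorem mem_diagonalSubmodule {a : HadamardSeries K} :
    a ∈ diagonalSubmodule K n ↔ IsDiagonal n (HadamardSeries.of.symm a) := Iff.rfl

theorem diagonalSubmodule_mono : Monotone (diagonalSubmodule K) :=
  fun _ _ hkl _ ha => mem_diagonalSubmodule.2 ((mem_diagonalSubmodule.1 ha).mono hkl)

theorem one_mem_diagonalSubmodule : (1 : HadamardSeries K) ∈ diagonalSubmodule K 0 :=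
  mem_diagonalSubmodule.2 isDiagonal_zero_mk_one

theorem mul_mem_diagonalSubmodule {a b : HadamardSeries K} (ha : a ∈ diagonalSubmodule K m)
    (hb : b ∈ diagonalSubmodule K n) : a * b ∈ diagonalSubmodule K (m + n) :=
  mem_diagonalSubmodule.2 ((mem_diagonalSubmodule.1 ha).hadamard (mem_diagonalSubmodule.1 hb))

/-- The algebra of all diagonals of rational functions under the Hadamard product. -/
noncomputable def diagonalSubalgebra (K : Type*) [Field K] : Subalgebra K (HadamardSeries K) where
  carrier := {a | ∃ k, a ∈ diagonalSubmodule K k}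
  add_mem' := by
    rintro a b ⟨k, hk⟩ ⟨l, hl⟩
    exact ⟨max k l, add_mem (diagonalSubmodule_mono (le_max_left k l) hk)
      (diagonalSubmodule_mono (le_max_right k l) hl)⟩
  mul_mem' := by
    rintro a b ⟨k, hk⟩ ⟨l, hl⟩
    exact ⟨k + l, mul_mem_diagonalSubmodule hk hl⟩
  algebraMap_mem' r := by
    rw [Algebra.algebraMap_eq_smul_one]
    exact ⟨0, Submodule.smul_mem _ r one_mem_diagonalSubmodule⟩

/-- The filtration of the algebra of diagonals by the number of variables. -/
noncomputable def diagonalFiltration (K : Type*) [Field K] (k : ℕ) :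
    Submodule K (diagonalSubalgebra K) :=
  (diagonalSubmodule K k).comap (diagonalSubalgebra K).val.toLinearMap

theorem isRingFiltration_diagonalFiltration (K : Type*) [Field K] :
    IsRingFiltration (diagonalFiltration K) (fun k => ⨆ j < k, diagonalFiltration K j) where
  mono _ _ hkl := Submodule.comap_mono (diagonalSubmodule_mono hkl)
  is_le {i _} hij := le_iSup₂_of_le i hij le_rfl
  is_sup _ _ h := iSup₂_le h
  one_mem := one_mem_diagonalSubmodule
  mul_mem _ _ _ _ ha hb := mul_mem_diagonalSubmodule ha hb

end Diagonal

end DiagonalGrade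

theorem propositionp_general (K : Type*) [Field K] :
    (∀ k₁ k₂ : ℕ,
      Set.image2 DiagonalGrade.hadamard
          (DiagonalGrade.diagonalsLE K k₁) (DiagonalGrade.diagonalsLE K k₂) ⊆
        DiagonalGrade.diagonalsLE K (k₁ + k₂)) ∧
    ∃ (A : Subalgebra K (DiagonalGrade.HadamardSeries K)) (F : ℕ → Submodule K A),
      (∀ a : DiagonalGrade.HadamardSeries K,
        a ∈ A ↔ DiagonalGrade.HadamardSeries.of.symm a ∈ DiagonalGrade.diagonals K) ∧
      (∀ (k : ℕ) (a : A),
        a ∈ F k ↔ DiagonalGrade.HadamardSeries.of.symm (a : DiagonalGrade.HadamardSeries K) ∈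
          DiagonalGrade.diagonalsLE K k) ∧
      IsRingFiltration F (fun k => ⨆ j < k, F j) ∧
      (∀ a : A, ∃ k, a ∈ F k) := by
  refine ⟨?_, DiagonalGrade.diagonalSubalgebra K, DiagonalGrade.diagonalFiltration K,
    fun a => DiagonalGrade.mem_diagonals_iff.symm,
    fun k a => DiagonalGrade.mem_diagonalsLE_iff.symm,
    DiagonalGrade.isRingFiltration_diagonalFiltration K, fun a => a.2⟩
  rintro k₁ k₂ _ ⟨f, hf, g, hg, rfl⟩
  rw [DiagonalGrade.mem_diagonalsLE_iff] at *
  exact hf.hadamard hg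

theorem propositionp (K : Type*) [Field K] [NumberField K] :
    (∀ k₁ k₂ : ℕ,
      Set.image2 DiagonalGrade.hadamard
          (DiagonalGrade.diagonalsLE K k₁) (DiagonalGrade.diagonalsLE K k₂) ⊆
        DiagonalGrade.diagonalsLE K (k₁ + k₂)) ∧
    ∃ (A : Subalgebra K (DiagonalGrade.HadamardSeries K)) (F : ℕ → Submodule K A),
      (∀ a : DiagonalGrade.HadamardSeries K,
        a ∈ A ↔ DiagonalGrade.HadamardSeries.of.symm a ∈ DiagonalGrade.diagonals K) ∧
      (∀ (k : ℕ) (a : A),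
        a ∈ F k ↔ DiagonalGrade.HadamardSeries.of.symm (a : DiagonalGrade.HadamardSeries K) ∈
          DiagonalGrade.diagonalsLE K k) ∧
      IsRingFiltration F (fun k => ⨆ j < k, F j) ∧
      (∀ a : A, ∃ k, a ∈ F k) :=
  propositionp_general K
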